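/- Let $G$ be a second countable, locally compact Hausdorff groupoid with unit space $G^0$, range and source maps $r,s$, fibres $G^u=r^{-1}(\{u\})$, and a fixed left Haar system $\{\lambda^u\}_{u\in G^0}$. Let $E^2$ be the set of continuous sections $\xi=(\xi^u)_{u\in G^0}$, $\xi^u\in L^2(G^u,\lambda^u)$, of the left regular Hilbert bundle $\{L^2(G^u)\}$ (that is, for every $u_0\in G^0$ and $\varepsilon>0$ there is $f\in C_c(G)$ with $\|\xi^u-f|_{G^u}\|\le\varepsilon$ for all $u$ in a neighbourhood of $u_0$) that vanish at infinity, i.e. $\|\xi^u\|\to 0$ as $u\to\infty$ in $G^0$. For $\xi,\eta\in E^2$ the coefficient $(\xi,\eta):G\to\mathbb C$ is $$(\xi,\eta)(x)=\langle L_x\xi^{s(x)},\eta^{r(x)}\rangle=\int \overline{\xi^{s(x)}(x^{-1}t)}\,\eta^{r(x)}(t)\,d\lambda^{r(x)}(t),\qquad (L_x\zeta)(t)=\zeta(x^{-1}t).$$ A bounded continuous function $\phi:G\to\mathbb C$ is positive definite if $\iint \phi(y^{-1}x)f(y)\overline{f(x)}\,d\lambda^u(x)\,d\lambda^u(y)\ge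 0$ for all $u\in G^0$ and $f\in C_c(G)$. Let $A_c(G)$ be the algebra of functions on $G$ generated, under pointwise operations, by the coefficients $(f,g)$ with $f,g\in C_c(G)$. Suppose that $G$ is $r$-discrete, i.e. $G^0$ is open in $G$. Then: (i) every compactly supported positive definite continuous function $\phi$ on $G$ is of the form $\phi=(\xi,\xi)$ for some $\xi\in E^2$; (ii) every $\phi\in A_c(G)$ is a sum of two coefficients of $E^2$: $\phi=(\xi_1,\eta_1)+(\xi_2,\eta_2)$ with $\xi_1,\eta_1,\xi_2,\eta_2\in E^2$. -/

import Mathlib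

open scoped CompactlySupported BoundedContinuousFunction ComplexOrder ENNReal Topology

/-- A topological groupoid structure on `G`. The unit space `G⁰` is the subset `units` of `G`, `r` and
`s` are the range and source maps. The product `mul x y` is meaningful only when `s x = r y`; its
values at other pairs are never used, and all laws concern composable pairs only. -/
structure TopGroupoid (G : Type*) [TopologicalSpace G] where
  units : Set G
  r : G → units
  s : G → units
  mul : G → G → G
  inv : G → G
  r_unit : ∀ u : units, r (u : G) = u
  s_unit : ∀ u : units, s (u : G) = u
  r_mul : ∀ x y, s x = r y → r (mul x y) = r x
  s_mul : ∀ x y, s x = r y → s (mul x y) = s y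
  assoc : ∀ x y z, s x = r y → s y = r z → mul (mul x y) z = mul x (mul y z)
  unit_mul : ∀ x, mul (r x) x = x
  mul_unit : ∀ x, mul x (s x) = x
  r_inv : ∀ x, r (inv x) = s x
  s_inv : ∀ x, s (inv x) = r x
  mul_inv : ∀ x, mul x (inv x) = (r x : G)
  inv_mul : ∀ x, mul (inv x) x = (s x : G)
  continuousOn_mul : ContinuousOn (fun p : G × G => mul p.1 p.2) {p | s p.1 = r p.2}
  continuous_inv : Continuous inv

namespace TopGroupoid

variable {G : Type*} [TopologicalSpace G]

/-- `G` is r-discrete: the unit space is open in `G`. -/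
def IsRDiscrete (𝒢 : TopGroupoid G) : Prop := IsOpen 𝒢.units

/-- The fibre `G^u = r⁻¹({u})`. -/
def fibre (𝒢 : TopGroupoid G) (u : 𝒢.units) : Set G := {x | 𝒢.r x = u}

theorem continuous_r (𝒢 : TopGroupoid G) : Continuous 𝒢.r := by
  refine continuous_induced_rng.2 ?_
  have h : Continuous fun x => 𝒢.mul x (𝒢.inv x) :=
    𝒢.continuousOn_mul.comp_continuous (f := fun x => (x, 𝒢.inv x))
      (continuous_id.prodMk 𝒢.continuous_inv) (fun x => (𝒢.r_inv x).symm)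
  exact h.congr 𝒢.mul_inv

theorem inv_mul_cancel_left (𝒢 : TopGroupoid G) {x y : G} (h : 𝒢.s x = 𝒢.r y) :
    𝒢.mul (𝒢.inv x) (𝒢.mul x y) = y := by
  rw [← 𝒢.assoc _ _ _ (𝒢.s_inv x) h, 𝒢.inv_mul, h, 𝒢.unit_mul]

theorem mul_inv_cancel_left (𝒢 : TopGroupoid G) {x y : G} (h : 𝒢.r x = 𝒢.r y) :
    𝒢.mul x (𝒢.mul (𝒢.inv x) y) = y := by
  rw [← 𝒢.assoc _ _ _ (𝒢.r_inv x).symm ((𝒢.s_inv x).trans h), 𝒢.mul_inv, h, 𝒢.unit_mul]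

theorem isClosed_fibre [T2Space G] (𝒢 : TopGroupoid G) (u : 𝒢.units) :
    IsClosed (𝒢.fibre u) := isClosed_singleton.preimage 𝒢.continuous_r

theorem continuousOn_translate (𝒢 : TopGroupoid G) (x : G) :
    ContinuousOn (fun t => 𝒢.mul x t) (𝒢.fibre (𝒢.s x)) :=
  𝒢.continuousOn_mul.comp (f := fun t => (x, t)) (by fun_prop) (fun _ ht => Eq.symm ht)

/-- A left Haar system: Radon measures `λ^u` (on the second countable locally compact Hausdorff
space `G`: Borel measures that are finite on compact sets) with support `G^u`, continuous in `u` and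
left invariant. -/
structure HaarSystem [MeasurableSpace G] (𝒢 : TopGroupoid G) where
  meas : 𝒢.units → MeasureTheory.Measure G
  finite_compact : ∀ u, MeasureTheory.IsFiniteMeasureOnCompacts (meas u)
  concentrated : ∀ u, meas u (𝒢.fibre u)ᶜ = 0
  full_support : ∀ u (V : Set G), IsOpen V → (V ∩ 𝒢.fibre u).Nonempty → 0 < meas u V
  continuous_integral : ∀ f : C_c(G, ℂ), Continuous fun u => ∫ x, f x ∂(meas u)
  left_invariant : ∀ (x : G) (f : C_c(G, ℂ)),
    ∫ y, f (𝒢.mul x y) ∂(meas (𝒢.s x)) = ∫ y, f y ∂(meas (𝒢.r x))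

namespace HaarSystem

variable [MeasurableSpace G] {𝒢 : TopGroupoid G}

instance (Λ : 𝒢.HaarSystem) (u : 𝒢.units) :
    MeasureTheory.IsFiniteMeasureOnCompacts (Λ.meas u) := Λ.finite_compact u

theorem restrict_fibre (Λ : 𝒢.HaarSystem) (u : 𝒢.units) :
    (Λ.meas u).restrict (𝒢.fibre u) = Λ.meas u :=
  MeasureTheory.Measure.restrict_eq_self_of_ae_mem
    (MeasureTheory.mem_ae_iff.2 (Λ.concentrated u))

theorem aemeasurable_translate [T2Space G] [BorelSpace G] (Λ : 𝒢.HaarSystem) (x : G) :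
    AEMeasurable (fun t => 𝒢.mul (𝒢.inv x) t) (Λ.meas (𝒢.r x)) := by
  rw [← Λ.restrict_fibre, ← 𝒢.s_inv x]
  exact (𝒢.continuousOn_translate (𝒢.inv x)).aemeasurable (𝒢.isClosed_fibre _).measurableSet

section

variable [LocallyCompactSpace G] [T2Space G] [SecondCountableTopology G] [BorelSpace G]

theorem map_translate (Λ : 𝒢.HaarSystem) (x : G) :
    (Λ.meas (𝒢.r x)).map (fun t => 𝒢.mul (𝒢.inv x) t) = Λ.meas (𝒢.s x) := by
  have : MeasureTheory.IsFiniteMeasureOnCompacts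
      ((Λ.meas (𝒢.r x)).map (fun t => 𝒢.mul (𝒢.inv x) t)) := by
    refine ⟨fun K hK => ?_⟩
    rw [MeasureTheory.Measure.map_apply_of_aemeasurable (Λ.aemeasurable_translate x)
      hK.measurableSet, ← Λ.restrict_fibre, MeasureTheory.Measure.restrict_apply'
      (𝒢.isClosed_fibre _).measurableSet]
    have hc : IsCompact ((fun t => 𝒢.mul x t) '' (K ∩ 𝒢.fibre (𝒢.s x))) :=
      (hK.inter_right (𝒢.isClosed_fibre _)).image_of_continuousOn
        ((𝒢.continuousOn_translate x).mono Set.inter_subset_right)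
    refine (MeasureTheory.measure_mono ?_).trans_lt hc.measure_lt_top
    rintro t ⟨ht, htr⟩
    have htr' : 𝒢.r t = 𝒢.r x := htr
    refine ⟨𝒢.mul (𝒢.inv x) t, ⟨ht, ?_⟩, 𝒢.mul_inv_cancel_left htr'.symm⟩
    exact (𝒢.r_mul _ _ ((𝒢.s_inv x).trans htr'.symm)).trans (𝒢.r_inv x)
  refine MeasureTheory.Measure.ext_of_integral_eq_on_compactlySupported fun f => ?_
  rw [MeasureTheory.integral_map (Λ.aemeasurable_translate x)
    (map_continuous f).aestronglyMeasurable]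
  let g : C_c(G, ℂ) :=
    { toFun := fun y => (f y : ℂ)
      continuous_toFun := Complex.continuous_ofReal.comp f.continuous
      hasCompactSupport' := f.hasCompactSupport.comp_left (g := Complex.ofReal) rfl }
  have h := Λ.left_invariant (𝒢.inv x) g
  rw [𝒢.s_inv, 𝒢.r_inv] at h
  have h' : ((∫ y, f (𝒢.mul (𝒢.inv x) y) ∂(Λ.meas (𝒢.r x)) : ℝ) : ℂ)
      = ((∫ y, f y ∂(Λ.meas (𝒢.s x)) : ℝ) : ℂ) := by
    rw [← integral_complex_ofReal, ← integral_complex_ofReal]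
    exact h
  exact_mod_cast h'

/-- The Hilbert space `L²(G^u) = L²(G, λ^u)`. -/
abbrev L2Fibre (Λ : 𝒢.HaarSystem) (u : 𝒢.units) : Type _ := MeasureTheory.Lp ℂ 2 (Λ.meas u)

/-- The left regular action `L_x : L²(G^{s(x)}) → L²(G^{r(x)})`, `(L_x ξ)(t) = ξ(x⁻¹t)`. -/
noncomputable def leftReg (Λ : 𝒢.HaarSystem) (x : G) (ξ : Λ.L2Fibre (𝒢.s x)) :
    Λ.L2Fibre (𝒢.r x) :=
  MeasureTheory.MemLp.toLp (fun t => ξ (𝒢.mul (𝒢.inv x) t))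
    (MeasureTheory.MemLp.comp_of_map
      (by rw [Λ.map_translate]; exact MeasureTheory.Lp.memLp ξ) (Λ.aemeasurable_translate x))

/-- The section `u ↦ f^u` of the left regular bundle given by `f ∈ C_c(G)`. -/
noncomputable def ofCc (Λ : 𝒢.HaarSystem) (f : C_c(G, ℂ)) (u : 𝒢.units) : Λ.L2Fibre u :=
  MeasureTheory.MemLp.toLp f (f.continuous.memLp_of_hasCompactSupport f.hasCompactSupport)

/-- `E²`: the continuous sections of the left regular bundle (those that are locally uniformly close
to sections from `C_c(G)`) that vanish at infinity on `G⁰`. -/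
def E2 (Λ : 𝒢.HaarSystem) : Set (∀ u, Λ.L2Fibre u) :=
  {ξ | (∀ u₀ : 𝒢.units, ∀ ε : ℝ, 0 < ε → ∃ f : C_c(G, ℂ), ∀ᶠ u in 𝓝 u₀, ‖ξ u - Λ.ofCc f u‖ ≤ ε) ∧
    Filter.Tendsto (fun u => ‖ξ u‖) (Filter.cocompact 𝒢.units) (𝓝 0)}

/-- The coefficient `(ξ, η)(x) = ⟨L_x ξ(s(x)), η(r(x))⟩`, conjugate linear in `ξ`. -/
noncomputable def coeff (Λ : 𝒢.HaarSystem) (ξ η : ∀ u, Λ.L2Fibre u) (x : G) : ℂ :=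
  inner ℂ (Λ.leftReg x (ξ (𝒢.s x))) (η (𝒢.r x))

/-- `A_cf(G)`: the coefficients `(f, g)` with `f, g ∈ C_c(G)`. -/
def Acf (Λ : 𝒢.HaarSystem) : Set (G → ℂ) :=
  {φ | ∃ f g : C_c(G, ℂ), φ = Λ.coeff (Λ.ofCc f) (Λ.ofCc g)}

/-- `A_c(G)`: the (not necessarily unital) algebra generated by `A_cf(G)` under pointwise
operations. -/
def Ac (Λ : 𝒢.HaarSystem) : NonUnitalSubalgebra ℂ (G → ℂ) := NonUnitalAlgebra.adjoin ℂ Λ.Acf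

end

/-- `P(G)`: the positive definite bounded continuous functions on `G`. -/
def PosDef (Λ : 𝒢.HaarSystem) : Set (G →ᵇ ℂ) :=
  {φ | ∀ (u : 𝒢.units) (f : C_c(G, ℂ)),
    0 ≤ ∫ y, ∫ x, φ (𝒢.mul (𝒢.inv y) x) * f y * starRingEnd ℂ (f x) ∂(Λ.meas u) ∂(Λ.meas u)}

end HaarSystem

end TopGroupoid

/-! When `G⁰` is open, each unit `u` is an atom of `λ^u`. Hence some `a ∈ C_c(G)` vanishing off `G⁰`
acts as a delta function: integration of `F * a` against `λ^u` returns `F u`, for all `u` in a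
prescribed compact set (`exists_unit_evaluation`).

For (i), convolution by `φ` gives operators `T_u` on `L²(G^u)`, bounded uniformly in `u` by the
Schur test, positive because `φ` is positive definite, and commuting with left translation. Put `ξ^u
= T_u^{1/2} a`. One polynomial approximates the square root on a common interval containing all
spectra, so `T_u^{1/2}` inherits the commutation, and `ξ` is a uniform limit of sections from
`C_c(G)`, hence in `E²`. Then `(ξ, ξ)(x) = ⟨L_x T a, a⟩ = φ(x)`.

For (ii), `A_c(G)` lies in `C_c(G)`, and every `f ∈ C_c(G)` is the coefficient `(f*, a)`; the second
summand can be zero. -/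

open MeasureTheory

/-! ### Square roots of positive operators and their polynomial approximation -/

section Operators

variable {H K : Type*} [NormedAddCommGroup H] [InnerProductSpace ℂ H]
  [NormedAddCommGroup K] [InnerProductSpace ℂ K]

/-- A positive operator on a complex Hilbert space has a self-adjoint square root that is
approximated by polynomials in it, with an error depending on a bound of its norm only. -/
theorem ContinuousLinearMap.IsPositive.exists_sqrt [CompleteSpace H] {A : H →L[ℂ] H}
    (hA : A.IsPositive) :
    ∃ S : H →L[ℂ] H, (∀ x y, inner ℂ (S x) y = inner ℂ x (S y)) ∧ (∀ x, S (S x) = A x) ∧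
      ∀ (M ε : ℝ) (p : Polynomial ℝ), 0 ≤ ε → ‖A‖ ≤ M →
        (∀ t ∈ Set.Icc 0 M, |p.eval t - √t| ≤ ε) → ‖S - Polynomial.aeval A p‖ ≤ ε := by
  have hA0 : 0 ≤ A := (ContinuousLinearMap.nonneg_iff_isPositive A).2 hA
  have hsa : IsSelfAdjoint A := hA.isSelfAdjoint
  refine ⟨CFC.sqrt A, fun x y => ?_, fun x => ?_, fun M ε p hε hM hp => ?_⟩
  · have h : IsSelfAdjoint (CFC.sqrt A) := (CFC.sqrt_nonneg A).isSelfAdjoint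
    exact h.isSymmetric x y
  · exact DFunLike.congr_fun (CFC.sqrt_mul_sqrt_self A hA0) x
  · have h1 : CFC.sqrt A = cfc Real.sqrt A := by
      rw [CFC.sqrt_eq_real_sqrt A hA0, cfcₙ_eq_cfc]
    rw [h1, ← cfc_polynomial p A hsa, ← cfc_sub Real.sqrt (fun x => p.eval x) A]
    refine norm_cfc_le hε fun t ht => ?_
    rw [norm_sub_rev]
    -- The spectrum lies in `[0, ‖A‖] ⊆ [0, M]`, where `p` is close to the square root.
    have h2 : ‖t‖ ≤ ‖A‖ := (spectrum.norm_le_norm_mul_of_mem ht).trans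
      (mul_le_of_le_one_right (norm_nonneg _) ContinuousLinearMap.norm_id_le)
    exact hp t ⟨spectrum_nonneg_of_nonneg hA0 ht, (le_abs_self t).trans (h2.trans hM)⟩

theorem ContinuousLinearMap.map_aeval_of_intertwines {A : H →L[ℂ] H} {B : K →L[ℂ] K}
    {V : H →L[ℂ] K} (hV : ∀ x, V (A x) = B (V x)) (p : Polynomial ℝ) (x : H) :
    V (Polynomial.aeval A p x) = Polynomial.aeval B p (V x) := by
  induction p using Polynomial.induction_on generalizing x with
  | C a => simp [Algebra.algebraMap_eq_smul_one]
  | add p q hp hq => simp [hp, hq]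
  | monomial n a h =>
    rw [pow_succ, ← mul_assoc, map_mul _ _ Polynomial.X, map_mul _ _ Polynomial.X,
      Polynomial.aeval_X, Polynomial.aeval_X]
    simp only [mul_apply_eq_comp, h, hV]

theorem exists_polynomial_near_sqrt (M : ℝ) {ε : ℝ} (hε : 0 < ε) :
    ∃ p : Polynomial ℝ, ∀ t ∈ Set.Icc 0 M, |p.eval t - √t| ≤ ε := by
  obtain ⟨p, hp⟩ := exists_polynomial_near_of_continuousOn 0 M Real.sqrt
    Real.continuous_sqrt.continuousOn ε hε
  exact ⟨p, fun t ht => (hp t ht).le⟩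

/-- Polynomials in `A` and `B` are intertwined by `V`, and this passes to norm limits provided the
same `p` serves both sides. `H` and `K` will be the spaces over the source and the range of an
element of `G`. -/
theorem ContinuousLinearMap.map_eq_of_polynomial_approx {A S : H →L[ℂ] H} {B R : K →L[ℂ] K}
    {V : H →L[ℂ] K} (hV : ∀ x, V (A x) = B (V x))
    (h : ∀ ε : ℝ, 0 < ε → ∃ p : Polynomial ℝ,
      ‖S - Polynomial.aeval A p‖ ≤ ε ∧ ‖R - Polynomial.aeval B p‖ ≤ ε) (x : H) :
    V (S x) = R (V x) := by
  have key : ∀ ε : ℝ, 0 < ε → ‖V (S x) - R (V x)‖ ≤ ε * (‖V‖ * ‖x‖ + ‖V x‖) := by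
    intro ε hε
    obtain ⟨p, h1, h2⟩ := h ε hε
    have e : V (S x) - R (V x) =
        V ((S - Polynomial.aeval A p) x) - (R - Polynomial.aeval B p) (V x) := by
      simp [map_aeval_of_intertwines hV p x]
    rw [e]
    calc _ ≤ ‖V ((S - Polynomial.aeval A p) x)‖ + ‖(R - Polynomial.aeval B p) (V x)‖ :=
          norm_sub_le _ _
      _ ≤ ‖V‖ * (ε * ‖x‖) + ε * ‖V x‖ := by
          gcongr
          · exact (V.le_opNorm _).trans (by gcongr; exact ContinuousLinearMap.le_of_opNorm_le _ h1 x)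
          · exact ContinuousLinearMap.le_of_opNorm_le _ h2 _
      _ = _ := by ring
  rw [← sub_eq_zero, ← norm_le_zero_iff]
  refine le_of_forall_pos_le_add fun δ hδ => ?_
  have hc : 0 ≤ ‖V‖ * ‖x‖ + ‖V x‖ := by positivity
  refine (key (δ / (‖V‖ * ‖x‖ + ‖V x‖ + 1)) (by positivity)).trans ?_
  rw [zero_add, div_mul_eq_mul_div, div_le_iff₀ (by positivity)]
  nlinarith

end Operators

/-! ### Schur test for integral operators on `L²` -/

section Schur

variable {X : Type*} [MeasurableSpace X] {μ : Measure X}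

/-- Cauchy–Schwarz for the splitting `k g = k^{1/2} (k g²)^{1/2}`. -/
theorem lintegral_mul_sq_le_of_lintegral_le {k g : X → ℝ≥0∞} (hk : AEMeasurable k μ)
    (hg : AEMeasurable g μ) {C : ℝ≥0∞} (hC : ∫⁻ t, k t ∂μ ≤ C) :
    (∫⁻ t, k t * g t ∂μ) ^ 2 ≤ C * ∫⁻ t, k t * g t ^ 2 ∂μ := by
  have h := ENNReal.lintegral_mul_norm_pow_le (μ := μ) hk (hk.mul (hg.pow_const 2))
    (p := 1 / 2) (q := 1 / 2) (by norm_num) (by norm_num) (by norm_num)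
  have e : ∀ t, k t ^ (1 / 2 : ℝ) * (k t * g t ^ 2) ^ (1 / 2 : ℝ) = k t * g t := fun t => by
    rw [← ENNReal.mul_rpow_of_nonneg _ _ (by norm_num), ← mul_assoc, ← sq, ← mul_pow,
      ← ENNReal.rpow_natCast, ← ENNReal.rpow_mul]
    norm_num
  simp only [Pi.mul_apply, e] at h
  calc _ ≤ ((∫⁻ t, k t ∂μ) ^ (1 / 2 : ℝ) * (∫⁻ t, k t * g t ^ 2 ∂μ) ^ (1 / 2 : ℝ)) ^ 2 := by
        gcongr
    _ = (∫⁻ t, k t ∂μ) * ∫⁻ t, k t * g t ^ 2 ∂μ := by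
        rw [mul_pow, ← ENNReal.rpow_natCast, ← ENNReal.rpow_mul, ← ENNReal.rpow_natCast,
          ← ENNReal.rpow_mul]
        norm_num
    _ ≤ _ := by gcongr

theorem lintegral_lintegral_mul_sq_le [SFinite μ] {k : X → X → ℝ≥0∞}
    (hk : Measurable (Function.uncurry k)) {g : X → ℝ≥0∞} (hg : AEMeasurable g μ) {C : ℝ≥0∞}
    (h₁ : ∀ᵐ y ∂μ, ∫⁻ t, k y t ∂μ ≤ C) (h₂ : ∀ᵐ t ∂μ, ∫⁻ y, k y t ∂μ ≤ C) :
    ∫⁻ y, (∫⁻ t, k y t * g t ∂μ) ^ 2 ∂μ ≤ C ^ 2 * ∫⁻ t, g t ^ 2 ∂μ := by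
  have hm : AEMeasurable (Function.uncurry fun y t => k y t * g t ^ 2) (μ.prod μ) :=
    hk.aemeasurable.mul ((hg.comp_snd (μ := μ)).pow_const 2)
  calc _ ≤ ∫⁻ y, C * ∫⁻ t, k y t * g t ^ 2 ∂μ ∂μ := by
        refine lintegral_mono_ae (h₁.mono fun y hy => ?_)
        exact lintegral_mul_sq_le_of_lintegral_le (hk.of_uncurry_left).aemeasurable hg hy
    _ = C * ∫⁻ t, ∫⁻ y, k y t * g t ^ 2 ∂μ ∂μ := by
        rw [← lintegral_lintegral_swap hm]
        exact lintegral_const_mul'' _ hm.lintegral_prod_right'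
    _ = C * ∫⁻ t, (∫⁻ y, k y t ∂μ) * g t ^ 2 ∂μ := by
        congr 1
        refine lintegral_congr fun t => ?_
        rw [lintegral_mul_const _ hk.of_uncurry_right]
    _ ≤ C * ∫⁻ t, C * g t ^ 2 ∂μ := by
        gcongr 1
        exact lintegral_mono_ae (h₂.mono fun t ht => by gcongr)
    _ = _ := by rw [lintegral_const_mul'' _ (hg.pow_const 2), ← mul_assoc, sq]

/-- The Schur test. -/
theorem exists_clm_of_schur [SFinite μ] {k : X → X → ℂ}
    (hk : StronglyMeasurable (Function.uncurry k)) {C : ℝ} (hC : 0 ≤ C)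
    (h₁ : ∀ᵐ y ∂μ, ∫⁻ t, ‖k y t‖ₑ ∂μ ≤ ENNReal.ofReal C)
    (h₂ : ∀ᵐ t ∂μ, ∫⁻ y, ‖k y t‖ₑ ∂μ ≤ ENNReal.ofReal C) :
    ∃ T : Lp ℂ 2 μ →L[ℂ] Lp ℂ 2 μ, (∀ g : Lp ℂ 2 μ, T g =ᵐ[μ] fun y => ∫ t, k y t * g t ∂μ) ∧
      ‖T‖ ≤ C := by
  have hb : ∀ g : Lp ℂ 2 μ, ∫⁻ y, (∫⁻ t, ‖k y t‖ₑ * ‖g t‖ₑ ∂μ) ^ 2 ∂μ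
      ≤ ENNReal.ofReal C ^ 2 * ∫⁻ t, ‖g t‖ₑ ^ 2 ∂μ := fun g =>
    lintegral_lintegral_mul_sq_le hk.enorm (Lp.aestronglyMeasurable g).enorm h₁ h₂
  have hL : ∀ f : X → ℂ, eLpNorm f 2 μ ^ 2 = ∫⁻ t, ‖f t‖ₑ ^ 2 ∂μ := fun f => by
    rw [eLpNorm_eq_lintegral_rpow_enorm_toReal two_ne_zero ENNReal.ofNat_ne_top,
      ← ENNReal.rpow_natCast, ← ENNReal.rpow_mul]
    simp
  have hjm : ∀ g : Lp ℂ 2 μ, AEMeasurable (fun y => ∫⁻ t, ‖k y t‖ₑ * ‖g t‖ₑ ∂μ) μ := fun g =>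
    AEMeasurable.lintegral_prod_right' (f := fun p : X × X => ‖k p.1 p.2‖ₑ * ‖g p.2‖ₑ)
      (hk.enorm.aemeasurable.mul ((Lp.aestronglyMeasurable g).enorm.comp_snd (μ := μ)))
  have hint : ∀ g : Lp ℂ 2 μ, ∀ᵐ y ∂μ, Integrable (fun t => k y t * g t) μ := fun g => by
    have hfin : ∫⁻ y, (∫⁻ t, ‖k y t‖ₑ * ‖g t‖ₑ ∂μ) ^ 2 ∂μ ≠ ∞ := by
      refine ((hb g).trans_lt ?_).ne
      rw [← hL]
      exact ENNReal.mul_lt_top (by simp) (by simpa using (Lp.eLpNorm_lt_top g))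
    -- A finite integral forces the inner integral to be finite for almost every `y`; this
    -- integrability is what makes the operator additive.
    refine (ae_lt_top' ((hjm g).pow_const 2) hfin).mono fun y hy => ?_
    refine ⟨(hk.of_uncurry_left (x := y)).aestronglyMeasurable.mul (Lp.aestronglyMeasurable g), ?_⟩
    rw [hasFiniteIntegral_iff_enorm]
    simp only [enorm_mul]
    exact (ENNReal.pow_lt_top_iff.1 hy).resolve_right two_ne_zero
  have hle : ∀ g : Lp ℂ 2 μ, eLpNorm (fun y => ∫ t, k y t * g t ∂μ) 2 μ
      ≤ ENNReal.ofReal C * eLpNorm g 2 μ := fun g => by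
    refine (ENNReal.pow_le_pow_left_iff two_ne_zero).1 ?_
    rw [mul_pow, hL, hL]
    refine le_trans (lintegral_mono fun y => ?_) (hb g)
    gcongr
    refine (enorm_integral_le_lintegral_enorm _).trans (le_of_eq ?_)
    simp only [enorm_mul]
  have hmem : ∀ g : Lp ℂ 2 μ, MemLp (fun y => ∫ t, k y t * g t ∂μ) 2 μ := fun g =>
    ⟨AEStronglyMeasurable.integral_prod_right' (f := fun p : X × X => k p.1 p.2 * g p.2)
      (hk.aestronglyMeasurable.mul ((Lp.aestronglyMeasurable g).comp_snd (μ := μ))),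
      (hle g).trans_lt (ENNReal.mul_lt_top (by simp) (Lp.eLpNorm_lt_top g))⟩
  let T : Lp ℂ 2 μ →ₗ[ℂ] Lp ℂ 2 μ :=
    { toFun := fun g => (hmem g).toLp
      map_add' := fun f g => by
        refine Lp.ext ?_
        filter_upwards [(hmem (f + g)).coeFn_toLp, (hmem f).coeFn_toLp, (hmem g).coeFn_toLp,
          Lp.coeFn_add (hmem f).toLp (hmem g).toLp, hint f, hint g] with y e1 e2 e3 e4 i1 i2
        rw [e1, e4, Pi.add_apply, e2, e3, ← integral_add i1 i2]
        refine integral_congr_ae ?_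
        filter_upwards [Lp.coeFn_add f g] with t ht
        rw [ht, Pi.add_apply, mul_add]
      map_smul' := fun c g => by
        refine Lp.ext ?_
        filter_upwards [(hmem (c • g)).coeFn_toLp, (hmem g).coeFn_toLp,
          Lp.coeFn_smul c (hmem g).toLp] with y e1 e2 e3
        rw [e1, RingHom.id_apply, e3, Pi.smul_apply, e2, ← integral_smul]
        refine integral_congr_ae ?_
        filter_upwards [Lp.coeFn_smul c g] with t ht
        rw [ht, Pi.smul_apply, smul_eq_mul, smul_eq_mul, mul_left_comm] }
  have hT : ∀ g, ‖T g‖ ≤ C * ‖g‖ := fun g => by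
    change ‖(hmem g).toLp‖ ≤ _
    rw [Lp.norm_toLp, Lp.norm_def]
    refine (ENNReal.toReal_mono (ENNReal.mul_ne_top (by simp) (Lp.eLpNorm_ne_top g))
      (hle g)).trans (le_of_eq ?_)
    rw [ENNReal.toReal_mul, ENNReal.toReal_ofReal hC]
  exact ⟨T.mkContinuous C hT, fun g => (hmem g).coeFn_toLp, T.mkContinuous_norm_le hC hT⟩

end Schur

namespace TopGroupoid

/-! ### Groupoid identities and the convolution kernel -/

section Algebra

variable {G : Type*} [TopologicalSpace G] (𝒢 : TopGroupoid G)

theorem continuous_s : Continuous 𝒢.s :=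
  (𝒢.continuous_r.comp 𝒢.continuous_inv).congr 𝒢.r_inv

theorem r_inv_mul {x t : G} (h : 𝒢.r x = 𝒢.r t) : 𝒢.r (𝒢.mul (𝒢.inv x) t) = 𝒢.s x :=
  (𝒢.r_mul _ _ ((𝒢.s_inv x).trans h)).trans (𝒢.r_inv x)

theorem inv_inv (x : G) : 𝒢.inv (𝒢.inv x) = x := by
  have h := 𝒢.inv_mul_cancel_left (𝒢.s_inv x)
  have h' := 𝒢.mul_unit (𝒢.inv (𝒢.inv x))
  rw [𝒢.s_inv, 𝒢.r_inv] at h'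
  rwa [𝒢.inv_mul, h'] at h

theorem inv_unit (u : 𝒢.units) : 𝒢.inv u = u := by
  have h := 𝒢.unit_mul (𝒢.inv u)
  have h' := 𝒢.mul_inv u
  rw [𝒢.r_inv, 𝒢.s_unit] at h
  rw [𝒢.r_unit] at h'
  exact h.symm.trans h'

theorem inv_mul_rev {x t : G} (h : 𝒢.r x = 𝒢.r t) :
    𝒢.inv (𝒢.mul (𝒢.inv x) t) = 𝒢.mul (𝒢.inv t) x := by
  have hs : 𝒢.s (𝒢.mul (𝒢.inv x) t) = 𝒢.r (𝒢.mul (𝒢.inv t) x) := by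
    rw [𝒢.s_mul _ _ ((𝒢.s_inv x).trans h), 𝒢.r_inv_mul h.symm]
  have e : 𝒢.mul (𝒢.mul (𝒢.inv x) t) (𝒢.mul (𝒢.inv t) x) = 𝒢.s x := by
    rw [𝒢.assoc _ _ _ ((𝒢.s_inv x).trans h) (𝒢.r_inv_mul h.symm).symm,
      𝒢.mul_inv_cancel_left h.symm, 𝒢.inv_mul]
  have h2 := 𝒢.inv_mul_cancel_left hs
  have h3 := 𝒢.mul_unit (𝒢.inv (𝒢.mul (𝒢.inv x) t))
  rw [𝒢.s_inv, 𝒢.r_inv_mul h] at h3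
  rwa [e, h3] at h2

/-- Left invariance of the argument `y⁻¹t` of the kernel, the source of the commutation with `L_x`.
-/
theorem inv_mul_inv_mul {x y t : G} (hy : 𝒢.r x = 𝒢.r y) (ht : 𝒢.r x = 𝒢.r t) :
    𝒢.mul (𝒢.inv (𝒢.mul (𝒢.inv x) y)) (𝒢.mul (𝒢.inv x) t) = 𝒢.mul (𝒢.inv y) t := by
  rw [𝒢.inv_mul_rev hy, 𝒢.assoc _ _ _ ((𝒢.s_inv y).trans hy.symm) (𝒢.r_inv_mul ht).symm,
    𝒢.mul_inv_cancel_left ht]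

/-- The function `φ*(x) = conj φ(x⁻¹)`. -/
noncomputable def starCc (f : C_c(G, ℂ)) : C_c(G, ℂ) where
  toFun x := starRingEnd ℂ (f (𝒢.inv x))
  continuous_toFun := Complex.continuous_conj.comp (f.continuous.comp 𝒢.continuous_inv)
  hasCompactSupport' := (f.hasCompactSupport.comp_homeomorph
    (⟨⟨𝒢.inv, 𝒢.inv, 𝒢.inv_inv, 𝒢.inv_inv⟩, 𝒢.continuous_inv, 𝒢.continuous_inv⟩ :
      G ≃ₜ G)).comp_left (map_zero _)

theorem starCc_apply (f : C_c(G, ℂ)) (x : G) :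
    𝒢.starCc f x = starRingEnd ℂ (f (𝒢.inv x)) := rfl

/-- The kernel `(x, t) ↦ conj f(x⁻¹t)` extends from `{r x = r t}` to `G × G`. -/
theorem exists_kernel [T2Space G] [NormalSpace (G × G)] (f : C_c(G, ℂ)) :
    ∃ k : C(G × G, ℂ), ∀ x t, 𝒢.r x = 𝒢.r t →
      k (x, t) = starRingEnd ℂ (f (𝒢.mul (𝒢.inv x) t)) := by
  let D : Set (G × G) := {p | 𝒢.r p.1 = 𝒢.r p.2}
  have hD : IsClosed D := isClosed_eq (𝒢.continuous_r.comp continuous_fst)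
    (𝒢.continuous_r.comp continuous_snd)
  have hc : Continuous fun p : D => starRingEnd ℂ (f (𝒢.mul (𝒢.inv p.1.1) p.1.2)) := by
    refine Complex.continuous_conj.comp (f.continuous.comp ?_)
    refine 𝒢.continuousOn_mul.comp_continuous
      (f := fun p : D => (𝒢.inv p.1.1, p.1.2)) ?_ fun p => ?_
    · exact (𝒢.continuous_inv.comp (continuous_fst.comp continuous_subtype_val)).prodMk
        (continuous_snd.comp continuous_subtype_val)
    · exact (𝒢.s_inv _).trans p.2
  obtain ⟨k, hk⟩ := ContinuousMap.exists_restrict_eq hD ⟨_, hc⟩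
  exact ⟨k, fun x t h => DFunLike.congr_fun hk ⟨(x, t), h⟩⟩

end Algebra

/-! ### Sections coming from `C_c(G)` and bounds uniform in the unit -/

namespace HaarSystem

variable {G : Type*} [TopologicalSpace G] [MeasurableSpace G] {𝒢 : TopGroupoid G}
  (Λ : 𝒢.HaarSystem)

theorem ae_r_eq (u : 𝒢.units) : ∀ᵐ t ∂Λ.meas u, 𝒢.r t = u := Λ.concentrated u

theorem ae_eq_zero_of_notMem (f : C_c(G, ℂ)) {u : 𝒢.units} (hu : u ∉ 𝒢.r '' tsupport f) :
    f =ᵐ[Λ.meas u] 0 := by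
  filter_upwards [Λ.ae_r_eq u] with t ht
  by_contra h
  exact hu ⟨t, subset_tsupport _ h, ht⟩

/-- The integral is continuous in `u` and vanishes off the compact set `r(supp f)`. -/
theorem exists_norm_integral_le [T2Space G] (f : C_c(G, ℂ)) :
    ∃ C : ℝ, ∀ u, ‖∫ t, f t ∂Λ.meas u‖ ≤ C := by
  refine (Λ.continuous_integral f).bounded_above_of_compact_support ?_
  refine HasCompactSupport.intro (f.hasCompactSupport.isCompact.image 𝒢.continuous_r)
    fun u hu => ?_
  exact integral_eq_zero_of_ae (Λ.ae_eq_zero_of_notMem f hu)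

theorem exists_lintegral_enorm_le [T2Space G] [BorelSpace G] (f : C_c(G, ℂ)) :
    ∃ C : ℝ, 0 ≤ C ∧ ∀ u, ∫⁻ t, ‖f t‖ₑ ∂Λ.meas u ≤ ENNReal.ofReal C := by
  let g : C_c(G, ℂ) :=
    { toFun := fun t => (‖f t‖ : ℂ)
      continuous_toFun := by fun_prop
      hasCompactSupport' := f.hasCompactSupport.comp_left (g := fun z : ℂ => (‖z‖ : ℂ)) (by simp) }
  obtain ⟨C, hC⟩ := Λ.exists_norm_integral_le g
  refine ⟨max C 0, le_max_right _ _, fun u => ?_⟩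
  have hi : Integrable f (Λ.meas u) := f.continuous.integrable_of_hasCompactSupport
    f.hasCompactSupport
  rw [← ofReal_integral_norm_eq_lintegral_enorm hi]
  refine ENNReal.ofReal_le_ofReal ((le_trans ?_ (hC u)).trans (le_max_left _ _))
  have e : ∫ t, g t ∂Λ.meas u = ((∫ t, ‖f t‖ ∂Λ.meas u : ℝ) : ℂ) := integral_complex_ofReal
  rw [e, Complex.norm_real]
  exact le_abs_self _

section

variable [BorelSpace G]

theorem coeFn_ofCc (f : C_c(G, ℂ)) (u : 𝒢.units) :
    Λ.ofCc f u =ᵐ[Λ.meas u] f :=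
  MemLp.coeFn_toLp _

theorem inner_ofCc (f g : C_c(G, ℂ)) (u : 𝒢.units) :
    inner ℂ (Λ.ofCc f u) (Λ.ofCc g u) = ∫ t, starRingEnd ℂ (f t) * g t ∂Λ.meas u := by
  rw [L2.inner_def]
  refine integral_congr_ae ?_
  filter_upwards [Λ.coeFn_ofCc f u, Λ.coeFn_ofCc g u] with t h1 h2
  rw [h1, h2, RCLike.inner_apply, mul_comm]

theorem ofCc_eq_zero_of_notMem (f : C_c(G, ℂ)) {u : 𝒢.units} (hu : u ∉ 𝒢.r '' tsupport f) :
    Λ.ofCc f u = 0 := by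
  refine Lp.ext ?_
  exact (Λ.coeFn_ofCc f u).trans ((Λ.ae_eq_zero_of_notMem f hu).trans
    (Lp.coeFn_zero ℂ 2 (Λ.meas u)).symm)

theorem ofCc_add (f g : C_c(G, ℂ)) (u : 𝒢.units) :
    Λ.ofCc (f + g) u = Λ.ofCc f u + Λ.ofCc g u := rfl

theorem ofCc_smul (c : ℂ) (f : C_c(G, ℂ)) (u : 𝒢.units) :
    Λ.ofCc (c • f) u = c • Λ.ofCc f u := rfl

theorem exists_norm_ofCc_le [T2Space G] (f : C_c(G, ℂ)) :
    ∃ C : ℝ, 0 ≤ C ∧ ∀ u, ‖Λ.ofCc f u‖ ≤ C := by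
  let g : C_c(G, ℂ) :=
    { toFun := fun t => starRingEnd ℂ (f t) * f t
      continuous_toFun := (Complex.continuous_conj.comp f.continuous).mul f.continuous
      hasCompactSupport' := f.hasCompactSupport.mul_left }
  obtain ⟨C, hC⟩ := Λ.exists_norm_integral_le g
  refine ⟨√C, Real.sqrt_nonneg _, fun u => Real.le_sqrt_of_sq_le ?_⟩
  have h : ‖inner ℂ (Λ.ofCc f u) (Λ.ofCc f u)‖ ≤ C := by
    rw [Λ.inner_ofCc]; exact hC u
  rwa [inner_self_eq_norm_sq_to_K, norm_pow, RCLike.norm_ofReal, abs_norm] at h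

/-- A section that is a uniform limit of sections from `C_c(G)` belongs to `E²`. -/
theorem mem_E2_of_uniform_approx {ξ : ∀ u, Λ.L2Fibre u}
    (h : ∀ ε : ℝ, 0 < ε → ∃ f : C_c(G, ℂ), ∀ u, ‖ξ u - Λ.ofCc f u‖ ≤ ε) : ξ ∈ Λ.E2 := by
  refine ⟨fun u₀ ε hε => ?_, ?_⟩
  · obtain ⟨f, hf⟩ := h ε hε
    exact ⟨f, Filter.Eventually.of_forall hf⟩
  · rw [Metric.tendsto_nhds]
    intro ε hε
    obtain ⟨f, hf⟩ := h (ε / 2) (half_pos hε)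
    filter_upwards [(f.hasCompactSupport.isCompact.image 𝒢.continuous_r).compl_mem_cocompact]
      with u hu
    have h1 := hf u
    rw [Λ.ofCc_eq_zero_of_notMem f hu, sub_zero] at h1
    rw [dist_zero_right, norm_norm]
    linarith

theorem ofCc_mem_E2 (f : C_c(G, ℂ)) : Λ.ofCc f ∈ Λ.E2 :=
  Λ.mem_E2_of_uniform_approx fun ε hε => ⟨f, fun u => by simpa using hε.le⟩

theorem zero_mem_E2 : (0 : ∀ u, Λ.L2Fibre u) ∈ Λ.E2 := Λ.ofCc_mem_E2 0

end

/-! ### Left translation and coefficients of `C_c(G)` -/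

section

variable [LocallyCompactSpace G] [T2Space G] [SecondCountableTopology G] [BorelSpace G]

theorem ae_translate (x : G) {P : G → Prop} (h : ∀ᵐ t ∂Λ.meas (𝒢.s x), P t) :
    ∀ᵐ t ∂Λ.meas (𝒢.r x), P (𝒢.mul (𝒢.inv x) t) := by
  rw [← Λ.map_translate] at h
  exact ae_of_ae_map (Λ.aemeasurable_translate x) h

theorem integral_translate (x : G) {F : G → ℂ}
    (hF : AEStronglyMeasurable F (Λ.meas (𝒢.s x))) :
    ∫ t, F (𝒢.mul (𝒢.inv x) t) ∂Λ.meas (𝒢.r x) = ∫ t, F t ∂Λ.meas (𝒢.s x) := by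
  rw [← Λ.map_translate] at hF ⊢
  rw [integral_map (Λ.aemeasurable_translate x) hF]

theorem lintegral_translate (x : G) {F : G → ℝ≥0∞} (hF : Measurable F) :
    ∫⁻ t, F (𝒢.mul (𝒢.inv x) t) ∂Λ.meas (𝒢.r x) = ∫⁻ t, F t ∂Λ.meas (𝒢.s x) := by
  rw [← Λ.map_translate, lintegral_map' hF.aemeasurable (Λ.aemeasurable_translate x)]

theorem coeFn_leftReg (x : G) (ξ : Λ.L2Fibre (𝒢.s x)) :
    Λ.leftReg x ξ =ᵐ[Λ.meas (𝒢.r x)] fun t => ξ (𝒢.mul (𝒢.inv x) t) :=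
  MemLp.coeFn_toLp _

theorem coeff_ofCc (f g : C_c(G, ℂ)) (x : G) :
    Λ.coeff (Λ.ofCc f) (Λ.ofCc g) x
      = ∫ t, starRingEnd ℂ (f (𝒢.mul (𝒢.inv x) t)) * g t ∂Λ.meas (𝒢.r x) := by
  rw [coeff, L2.inner_def]
  refine integral_congr_ae ?_
  filter_upwards [Λ.coeFn_leftReg x (Λ.ofCc f (𝒢.s x)), Λ.coeFn_ofCc g (𝒢.r x),
    Λ.ae_translate x (Λ.coeFn_ofCc f (𝒢.s x))] with t h1 h2 h3
  rw [h1, h2, h3, RCLike.inner_apply, mul_comm]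

/-- Both integrand and measure move with `x`. With the integrand frozen at `x₀`, the Haar system
axiom applies; the remaining error is small because the kernel varies uniformly on the support of
`g` and the masses `∫ |g| dλ^u` are bounded. -/
theorem continuous_coeff_ofCc (f g : C_c(G, ℂ)) :
    Continuous (Λ.coeff (Λ.ofCc f) (Λ.ofCc g)) := by
  obtain ⟨k, hk⟩ := 𝒢.exists_kernel f
  let F : G → C_c(G, ℂ) := fun x =>
    { toFun := fun t => k (x, t) * g t
      continuous_toFun := by fun_prop
      hasCompactSupport' := g.hasCompactSupport.mul_left }
  have e : ∀ x, Λ.coeff (Λ.ofCc f) (Λ.ofCc g) x = ∫ t, F x t ∂Λ.meas (𝒢.r x) := fun x => by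
    rw [coeff_ofCc]
    refine integral_congr_ae ?_
    filter_upwards [Λ.ae_r_eq (𝒢.r x)] with t ht
    change _ = k (x, t) * g t
    rw [hk x t ht.symm]
  rw [funext e, continuous_iff_continuousAt]
  intro x₀
  obtain ⟨C, hC0, hC⟩ := Λ.exists_lintegral_enorm_le g
  have hint : ∀ (f : C_c(G, ℂ)) u, Integrable f (Λ.meas u) := fun f u =>
    f.continuous.integrable_of_hasCompactSupport f.hasCompactSupport
  have hCn : ∀ u, ∫ t, ‖g t‖ ∂Λ.meas u ≤ C := fun u => by
    have := hC u
    rwa [← ofReal_integral_norm_eq_lintegral_enorm (hint g u),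
      ENNReal.ofReal_le_ofReal_iff hC0] at this
  have h2 : Filter.Tendsto (fun x => ∫ t, F x₀ t ∂Λ.meas (𝒢.r x)) (𝓝 x₀)
      (𝓝 (∫ t, F x₀ t ∂Λ.meas (𝒢.r x₀))) :=
    ((Λ.continuous_integral (F x₀)).comp 𝒢.continuous_r).continuousAt
  have h1 : Filter.Tendsto
      (fun x => ∫ t, F x t ∂Λ.meas (𝒢.r x) - ∫ t, F x₀ t ∂Λ.meas (𝒢.r x)) (𝓝 x₀) (𝓝 0) := by
    rw [Metric.tendsto_nhds]
    intro ε hε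
    have hδ : 0 < ε / (C + 1) := by positivity
    have hev : ∀ᶠ x in 𝓝 x₀, ∀ t ∈ tsupport g, dist (k (x₀, t)) (k (x, t)) < ε / (C + 1) := by
      have := (ContinuousMap.tendsto_iff_forall_isCompact_tendstoUniformlyOn.1
        (k.curry.continuous.tendsto x₀)) _ g.hasCompactSupport.isCompact
      exact Metric.tendstoUniformlyOn_iff.1 this _ hδ
    filter_upwards [hev] with x hx
    rw [← integral_sub (hint _ _) (hint _ _), dist_zero_right]
    calc ‖∫ t, (F x t - F x₀ t) ∂Λ.meas (𝒢.r x)‖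
        ≤ ∫ t, ε / (C + 1) * ‖g t‖ ∂Λ.meas (𝒢.r x) := by
          refine norm_integral_le_of_norm_le ((hint g _).norm.const_mul _)
            (Filter.Eventually.of_forall fun t => ?_)
          change ‖k (x, t) * g t - k (x₀, t) * g t‖ ≤ _
          rw [← sub_mul, norm_mul]
          by_cases ht : t ∈ tsupport g
          · gcongr
            rw [← dist_eq_norm, dist_comm]
            exact (hx t ht).le
          · simp [image_eq_zero_of_notMem_tsupport ht]
      _ ≤ ε / (C + 1) * C := by
          rw [integral_const_mul]
          gcongr
          exact hCn _
      _ < ε := by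
          rw [div_mul_eq_mul_div, div_lt_iff₀ (by positivity)]
          nlinarith
  have h3 := h1.add h2
  simp only [sub_add_cancel, zero_add] at h3
  exact h3

/-- If the integrand is nonzero at `t`, then `x = t (x⁻¹t)⁻¹` lies in the compact product `supp g ·
(supp f)⁻¹`. -/
theorem hasCompactSupport_coeff_ofCc (f g : C_c(G, ℂ)) :
    HasCompactSupport (Λ.coeff (Λ.ofCc f) (Λ.ofCc g)) := by
  let D : Set (G × G) := {p | 𝒢.s p.1 = 𝒢.r p.2}
  have hD : IsClosed D := isClosed_eq (𝒢.continuous_s.comp continuous_fst)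
    (𝒢.continuous_r.comp continuous_snd)
  have hK : IsCompact ((fun p : G × G => 𝒢.mul p.1 p.2) ''
      ((tsupport g ×ˢ (𝒢.inv '' tsupport f)) ∩ D)) :=
    ((g.hasCompactSupport.isCompact.prod
      (f.hasCompactSupport.isCompact.image 𝒢.continuous_inv)).inter_right hD).image_of_continuousOn
      (𝒢.continuousOn_mul.mono Set.inter_subset_right)
  refine HasCompactSupport.intro hK fun x hx => ?_
  rw [coeff_ofCc]
  refine integral_eq_zero_of_ae ?_
  filter_upwards [Λ.ae_r_eq (𝒢.r x)] with t ht
  by_contra h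
  have hm := mul_ne_zero_iff.1 h
  have hinv := 𝒢.inv_mul_rev ht.symm
  refine hx ⟨(t, 𝒢.inv (𝒢.mul (𝒢.inv x) t)), ⟨⟨subset_tsupport _ hm.2, _,
    subset_tsupport _ fun h0 => hm.1 (by rw [h0, map_zero]), rfl⟩, ?_⟩, ?_⟩
  · change 𝒢.s t = 𝒢.r (𝒢.inv _)
    rw [hinv, 𝒢.r_inv_mul ht]
  · change 𝒢.mul t (𝒢.inv _) = x
    rw [hinv, 𝒢.mul_inv_cancel_left ht]

/-- The coefficient `(f, g)` of `f, g ∈ C_c(G)`, as an element of `C_c(G)`. -/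
noncomputable def coeffCc (f g : C_c(G, ℂ)) : C_c(G, ℂ) where
  toFun := Λ.coeff (Λ.ofCc f) (Λ.ofCc g)
  continuous_toFun := Λ.continuous_coeff_ofCc f g
  hasCompactSupport' := Λ.hasCompactSupport_coeff_ofCc f g

theorem coeffCc_apply (f g : C_c(G, ℂ)) (x : G) :
    Λ.coeffCc f g x = ∫ t, starRingEnd ℂ (f (𝒢.mul (𝒢.inv x) t)) * g t ∂Λ.meas (𝒢.r x) :=
  Λ.coeff_ofCc f g x

theorem continuous_and_hasCompactSupport_of_mem_Ac {φ : G → ℂ} (hφ : φ ∈ Λ.Ac) :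
    Continuous φ ∧ HasCompactSupport φ := by
  induction hφ using NonUnitalAlgebra.adjoin_induction with
  | mem x hx =>
    obtain ⟨f, g, rfl⟩ := hx
    exact ⟨Λ.continuous_coeff_ofCc f g, Λ.hasCompactSupport_coeff_ofCc f g⟩
  | add x y _ _ hx hy => exact ⟨hx.1.add hy.1, hx.2.add hy.2⟩
  | zero => exact ⟨continuous_zero, HasCompactSupport.zero⟩
  | mul x y _ _ hx hy => exact ⟨hx.1.mul hy.1, hx.2.mul_right⟩
  | smul c x _ hx => exact ⟨hx.1.const_smul c, hx.2.smul_left (f := fun _ => c)⟩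

end

end HaarSystem

end TopGroupoid

/-! ### Convolution operators on the fibres -/

namespace TopGroupoid

namespace HaarSystem

variable {G : Type*} [TopologicalSpace G] [MeasurableSpace G] {𝒢 : TopGroupoid G}
  (Λ : 𝒢.HaarSystem)
  [LocallyCompactSpace G] [T2Space G] [SecondCountableTopology G] [BorelSpace G]

/-- By left invariance, the rows and columns of the kernel have the `L¹` norms of `f` and `f*` on
another fibre, which are bounded independently of the unit. -/
theorem exists_convOp (f : C_c(G, ℂ)) :
    ∃ (C : ℝ) (T : ∀ u, Λ.L2Fibre u →L[ℂ] Λ.L2Fibre u), ∀ u, ‖T u‖ ≤ C ∧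
      ∀ g : Λ.L2Fibre u, T u g =ᵐ[Λ.meas u]
        fun y => ∫ t, starRingEnd ℂ (f (𝒢.mul (𝒢.inv y) t)) * g t ∂Λ.meas u := by
  -- Off composable pairs `mul` is arbitrary, so joint measurability is only available for the
  -- continuous extension `k`.
  obtain ⟨k, hk⟩ := 𝒢.exists_kernel f
  obtain ⟨C₁, hC₁, h₁⟩ := Λ.exists_lintegral_enorm_le f
  obtain ⟨C₂, hC₂, h₂⟩ := Λ.exists_lintegral_enorm_le (𝒢.starCc f)
  have hT : ∀ u, ∃ T : Λ.L2Fibre u →L[ℂ] Λ.L2Fibre u,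
      (∀ g : Λ.L2Fibre u, T g =ᵐ[Λ.meas u] fun y => ∫ t, k (y, t) * g t ∂Λ.meas u) ∧
        ‖T‖ ≤ max C₁ C₂ := by
    refine fun u => exists_clm_of_schur (k := fun y t => k (y, t))
      k.continuous.stronglyMeasurable (hC₁.trans (le_max_left _ _)) ?_ ?_
    · filter_upwards [Λ.ae_r_eq u] with y hy
      subst hy
      refine le_trans (le_of_eq ?_) ((h₁ (𝒢.s y)).trans
        (ENNReal.ofReal_le_ofReal (le_max_left _ _)))
      rw [← Λ.lintegral_translate y (F := fun t => ‖f t‖ₑ) f.continuous.measurable.enorm]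
      refine lintegral_congr_ae ?_
      filter_upwards [Λ.ae_r_eq (𝒢.r y)] with t ht
      rw [hk y t ht.symm, RCLike.enorm_conj]
    · filter_upwards [Λ.ae_r_eq u] with t ht
      subst ht
      refine le_trans (le_of_eq ?_) ((h₂ (𝒢.s t)).trans
        (ENNReal.ofReal_le_ofReal (le_max_right _ _)))
      rw [← Λ.lintegral_translate t (F := fun y => ‖𝒢.starCc f y‖ₑ)
        (𝒢.starCc f).continuous.measurable.enorm]
      refine lintegral_congr_ae ?_
      filter_upwards [Λ.ae_r_eq (𝒢.r t)] with y hy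
      rw [hk y t hy, starCc_apply, 𝒢.inv_mul_rev hy.symm]
  choose T hT hTC using hT
  refine ⟨max C₁ C₂, T, fun u => ⟨hTC u, fun g => (hT u g).trans ?_⟩⟩
  filter_upwards [Λ.ae_r_eq u] with y hy
  refine integral_congr_ae ?_
  filter_upwards [Λ.ae_r_eq u] with t ht
  rw [hk y t (hy.trans ht.symm)]

/-- The bounded operator `(T g)(y) = ∫ conj f(y⁻¹t) g(t) dλ^u(t)` on `L²(G^u)`. -/
noncomputable def convOp (f : C_c(G, ℂ)) (u : 𝒢.units) : Λ.L2Fibre u →L[ℂ] Λ.L2Fibre u :=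
  (Λ.exists_convOp f).choose_spec.choose u

theorem coeFn_convOp (f : C_c(G, ℂ)) (u : 𝒢.units) (g : Λ.L2Fibre u) :
    Λ.convOp f u g =ᵐ[Λ.meas u]
      fun y => ∫ t, starRingEnd ℂ (f (𝒢.mul (𝒢.inv y) t)) * g t ∂Λ.meas u :=
  ((Λ.exists_convOp f).choose_spec.choose_spec u).2 g

theorem exists_norm_convOp_le (f : C_c(G, ℂ)) : ∃ C : ℝ, ∀ u, ‖Λ.convOp f u‖ ≤ C :=
  ⟨_, fun u => ((Λ.exists_convOp f).choose_spec.choose_spec u).1⟩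

theorem convOp_ofCc (f g : C_c(G, ℂ)) (u : 𝒢.units) :
    Λ.convOp f u (Λ.ofCc g u) = Λ.ofCc (Λ.coeffCc f g) u := by
  refine Lp.ext ?_
  filter_upwards [Λ.coeFn_convOp f u (Λ.ofCc g u), Λ.coeFn_ofCc (Λ.coeffCc f g) u,
    Λ.ae_r_eq u] with y h1 h2 hy
  subst hy
  rw [h1, h2, coeffCc_apply]
  refine integral_congr_ae ?_
  filter_upwards [Λ.coeFn_ofCc g (𝒢.r y)] with t ht
  rw [ht]

/-- The point is that a single `h` works for all `u`, so polynomials in the operators preserve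
sections from `C_c(G)`. -/
theorem exists_aeval_convOp_ofCc (f : C_c(G, ℂ)) (p : Polynomial ℝ) (g : C_c(G, ℂ)) :
    ∃ h : C_c(G, ℂ), ∀ u, Polynomial.aeval (Λ.convOp f u) p (Λ.ofCc g u) = Λ.ofCc h u := by
  induction p using Polynomial.induction_on generalizing g with
  | C a =>
    refine ⟨(a : ℂ) • g, fun u => ?_⟩
    rw [ofCc_smul, Polynomial.aeval_C, Algebra.algebraMap_eq_smul_one]
    exact (Complex.coe_smul a (Λ.ofCc g u)).symm
  | add p q hp hq =>
    obtain ⟨h₁, e₁⟩ := hp g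
    obtain ⟨h₂, e₂⟩ := hq g
    refine ⟨h₁ + h₂, fun u => ?_⟩
    rw [map_add, add_apply, e₁, e₂, ofCc_add]
  | monomial n a hp =>
    obtain ⟨h, e⟩ := hp (Λ.coeffCc f g)
    refine ⟨h, fun u => ?_⟩
    rw [pow_succ, ← mul_assoc, map_mul _ _ Polynomial.X, Polynomial.aeval_X,
      mul_apply_eq_comp, convOp_ofCc, e]

/-- The isometry `L_x : L²(G^{s(x)}) → L²(G^{r(x)})`. -/
noncomputable def leftRegL (x : G) : Λ.L2Fibre (𝒢.s x) →L[ℂ] Λ.L2Fibre (𝒢.r x) :=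
  LinearMap.mkContinuous
    { toFun := Λ.leftReg x
      map_add' := fun f g => by
        refine Lp.ext ?_
        filter_upwards [Λ.coeFn_leftReg x (f + g), Λ.coeFn_leftReg x f, Λ.coeFn_leftReg x g,
          Lp.coeFn_add (Λ.leftReg x f) (Λ.leftReg x g),
          Λ.ae_translate x (Lp.coeFn_add f g)] with t h1 h2 h3 h4 h5
        rw [h1, h5, h4, Pi.add_apply, Pi.add_apply, h2, h3]
      map_smul' := fun c f => by
        refine Lp.ext ?_
        filter_upwards [Λ.coeFn_leftReg x (c • f), Λ.coeFn_leftReg x f,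
          Lp.coeFn_smul c (Λ.leftReg x f),
          Λ.ae_translate x (Lp.coeFn_smul c f)] with t h1 h2 h3 h4
        rw [h1, h4, RingHom.id_apply, h3, Pi.smul_apply, Pi.smul_apply, h2] }
    1 fun f => by
      change ‖Λ.leftReg x f‖ ≤ _
      have hm : AEStronglyMeasurable f ((Λ.meas (𝒢.r x)).map fun t => 𝒢.mul (𝒢.inv x) t) := by
        rw [Λ.map_translate]
        exact Lp.aestronglyMeasurable f
      have h := eLpNorm_map_measure (p := 2) hm (Λ.aemeasurable_translate x)
      rw [Λ.map_translate] at h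
      rw [one_mul, Lp.norm_def, Lp.norm_def, eLpNorm_congr_ae (Λ.coeFn_leftReg x f), h]
      rfl

theorem leftReg_convOp (f : C_c(G, ℂ)) (x : G) (g : Λ.L2Fibre (𝒢.s x)) :
    Λ.leftReg x (Λ.convOp f (𝒢.s x) g) = Λ.convOp f (𝒢.r x) (Λ.leftReg x g) := by
  obtain ⟨k, hk⟩ := 𝒢.exists_kernel f
  refine Lp.ext ?_
  filter_upwards [Λ.coeFn_leftReg x (Λ.convOp f (𝒢.s x) g),
    Λ.ae_translate x (Λ.coeFn_convOp f (𝒢.s x) g), Λ.coeFn_convOp f (𝒢.r x) (Λ.leftReg x g),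
    Λ.ae_r_eq (𝒢.r x)] with y h1 h2 h3 hy
  rw [h1, h2, h3]
  have hz : 𝒢.r (𝒢.mul (𝒢.inv x) y) = 𝒢.s x := 𝒢.r_inv_mul hy.symm
  calc _ = ∫ t, k (𝒢.mul (𝒢.inv x) y, t) * g t ∂Λ.meas (𝒢.s x) := by
        refine integral_congr_ae ?_
        filter_upwards [Λ.ae_r_eq (𝒢.s x)] with t ht
        rw [hk _ t (hz.trans ht.symm)]
    _ = ∫ t, k (𝒢.mul (𝒢.inv x) y, 𝒢.mul (𝒢.inv x) t) * g (𝒢.mul (𝒢.inv x) t)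
          ∂Λ.meas (𝒢.r x) := by
        refine (Λ.integral_translate x (F := fun t => k (𝒢.mul (𝒢.inv x) y, t) * g t) ?_).symm
        refine Continuous.aestronglyMeasurable (by fun_prop) |>.mul (Lp.aestronglyMeasurable g)
    _ = _ := by
        refine integral_congr_ae ?_
        filter_upwards [Λ.ae_r_eq (𝒢.r x), Λ.coeFn_leftReg x g] with t ht h4
        rw [h4, hk _ _ (hz.trans (𝒢.r_inv_mul ht.symm).symm), 𝒢.inv_mul_inv_mul hy.symm ht.symm]

theorem dense_ofCc (u : 𝒢.units) : Dense (Set.range fun f : C_c(G, ℂ) => Λ.ofCc f u) := by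
  intro g
  rw [Metric.mem_closure_iff]
  intro ε hε
  obtain ⟨f, hf, hle, hc, hm⟩ := (Lp.memLp g).exists_hasCompactSupport_eLpNorm_sub_le
    ENNReal.ofNat_ne_top (ε := ENNReal.ofReal (ε / 2)) (by simpa using hε)
  refine ⟨_, ⟨⟨⟨f, hc⟩, hf⟩, rfl⟩, ?_⟩
  have e : g - Λ.ofCc ⟨⟨f, hc⟩, hf⟩ u = ((Lp.memLp g).sub hm).toLp := by
    rw [MemLp.toLp_sub (Lp.memLp g), Lp.toLp_coeFn _ (Lp.memLp g)]
    rfl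
  rw [dist_eq_norm, e, Lp.norm_toLp]
  refine (ENNReal.toReal_mono ENNReal.ofReal_ne_top hle).trans_lt ?_
  rw [ENNReal.toReal_ofReal (half_pos hε).le]
  exact half_lt_self hε

/-- On `C_c(G)` the quadratic form is exactly the double integral defining positive definiteness;
density extends it to `L²`. Over `ℂ`, a nonnegative form already forces symmetry. -/
theorem isPositive_convOp {φ : G →ᵇ ℂ} (hφ : φ ∈ Λ.PosDef) {f : C_c(G, ℂ)}
    (hf : ∀ x, f x = φ x) (u : 𝒢.units) : (Λ.convOp f u).IsPositive := by
  have hpos : ∀ g : Λ.L2Fibre u, 0 ≤ inner ℂ (Λ.convOp f u g) g := by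
    intro g
    refine (Λ.dense_ofCc u).induction (P := fun g => 0 ≤ inner ℂ (Λ.convOp f u g) g) ?_ ?_ g
    · rintro _ ⟨g, rfl⟩
      rw [convOp_ofCc, inner_ofCc]
      refine (hφ u g).trans_eq (integral_congr_ae ?_)
      filter_upwards [Λ.ae_r_eq u] with y hy
      subst hy
      rw [coeffCc_apply, ← integral_conj, ← integral_mul_const]
      refine integral_congr_ae (Filter.Eventually.of_forall fun t => ?_)
      simp only [map_mul, Complex.conj_conj, hf]
      ring
    · exact isClosed_Ici.preimage (((Λ.convOp f u).continuous).inner (𝕜 := ℂ) continuous_id)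
  refine (ContinuousLinearMap.isPositive_iff_complex _).2 fun g => ?_
  obtain ⟨h1, h2⟩ := Complex.le_def.1 (hpos g)
  refine ⟨Complex.ext ?_ ?_, h1⟩
  · simp
  · simpa using h2

/-! ### Evaluation at units and the two representation results -/

/-- If `G⁰` is open, the elements of `C_c(G)` supported in `G⁰` integrate to point evaluations
at units, up to a real weight that can be prescribed to be `1` on a compact set of units. -/
theorem exists_unit_evaluation (h𝒢 : 𝒢.IsRDiscrete) {L : Set 𝒢.units} (hL : IsCompact L) :
    ∃ (a : C_c(G, ℂ)) (w : 𝒢.units → ℝ), (∀ u ∈ L, w u = 1) ∧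
      ∀ u (F : G → ℂ), ∫ t, F t * a t ∂Λ.meas u = F u * w u := by
  have hL' : IsCompact ((↑) '' L : Set G) := hL.image continuous_subtype_val
  obtain ⟨χ, h1, h0, hχ, hI⟩ := exists_continuous_one_zero_of_isCompact hL' h𝒢.isClosed_compl
    (Set.disjoint_compl_right_iff_subset.2 (by rintro _ ⟨u, -, rfl⟩; exact u.2))
  let h : 𝒢.units → ℝ := fun u => (Λ.meas u).real {(u : G)}
  have hpos : ∀ u, 0 < h u := fun u => by
    -- The fibre `G^u` meets `G⁰` only in `u`, so openness of `G⁰` and full support give the atom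
    -- positive mass.
    have hu : Λ.meas u {(u : G)} = Λ.meas u 𝒢.units := by
      refine measure_congr ?_
      filter_upwards [Λ.ae_r_eq u] with t ht
      refine propext ⟨?_, ?_⟩
      · rintro rfl
        exact u.2
      · intro hu
        have := 𝒢.r_unit ⟨t, hu⟩
        exact congrArg Subtype.val (this.symm.trans ht)
    refine ENNReal.toReal_pos ?_ (isCompact_singleton.measure_lt_top).ne
    rw [hu]
    exact (Λ.full_support u _ h𝒢 ⟨u, u.2, 𝒢.r_unit u⟩).ne'
  have hev : ∀ b : G → ℂ, (∀ t ∉ 𝒢.units, b t = 0) → ∀ u,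
      ∫ t, b t ∂Λ.meas u = h u * b u := fun b hb u => by
    rw [← Complex.real_smul, ← integral_singleton]
    refine (setIntegral_eq_integral_of_ae_compl_eq_zero ?_).symm
    filter_upwards [Λ.ae_r_eq u] with t ht htu
    refine hb t fun hu => htu ?_
    exact congrArg Subtype.val ((𝒢.r_unit ⟨t, hu⟩).symm.trans ht)
  have h0' : ∀ t ∉ 𝒢.units, χ t = 0 := fun t ht => h0 ht
  let χ' : C_c(G, ℂ) :=
    { toFun := fun t => (χ t : ℂ)
      continuous_toFun := Complex.continuous_ofReal.comp χ.continuous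
      hasCompactSupport' := hχ.comp_left (g := Complex.ofReal) rfl }
  -- This product is the integral of `χ` against `λ^u`, hence continuous.
  have hψ : Continuous fun u => h u * χ u := by
    have := Complex.continuous_re.comp (Λ.continuous_integral χ')
    refine this.congr fun u => ?_
    have e := hev χ' (fun t ht => by change ((χ t : ℝ) : ℂ) = 0; rw [h0' t ht]; rfl) u
    simp only [Function.comp_apply, e]
    change ((h u : ℂ) * ((χ u : ℝ) : ℂ)).re = _
    rw [← Complex.ofReal_mul, Complex.ofReal_re]
  have hc : ∃ c : ℝ, 0 < c ∧ ∀ u ∈ L, c ≤ h u * χ u := by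
    rcases L.eq_empty_or_nonempty with rfl | hne
    · exact ⟨1, one_pos, by simp⟩
    · obtain ⟨v, hv, hmin⟩ := hL.exists_isMinOn hne hψ.continuousOn
      refine ⟨h v * χ v, ?_, hmin⟩
      rw [h1 (Set.mem_image_of_mem _ hv), Pi.one_apply, mul_one]
      exact hpos v
  obtain ⟨c, hc, hcL⟩ := hc
  -- Truncation below by `c` makes division safe everywhere and changes nothing on `L`.
  let d : 𝒢.units → ℝ := fun u => max (h u * χ u) c
  have hd : ∀ u, 0 < d u := fun u => lt_max_of_lt_right hc
  have hdc : Continuous d := hψ.max continuous_const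
  let a : C_c(G, ℂ) :=
    { toFun := fun t => ((χ t / d (𝒢.r t) : ℝ) : ℂ)
      continuous_toFun := Complex.continuous_ofReal.comp
        (χ.continuous.div (hdc.comp 𝒢.continuous_r) fun t => (hd _).ne')
      hasCompactSupport' := by
        refine hχ.mono fun t ht hχt => ht ?_
        simp [hχt] }
  refine ⟨a, fun u => h u * (χ u / d u), fun u hu => ?_, fun u F => ?_⟩
  · have hdu : d u = h u * χ u := max_eq_left (hcL u hu)
    have := (hd u).ne'
    change h u * (χ u / d u) = 1
    rw [← mul_div_assoc, ← hdu, div_self this]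
  · rw [hev (fun t => F t * a t) (fun t ht => ?_) u]
    · change _ * (F u * ((χ u / d (𝒢.r u) : ℝ) : ℂ)) = _
      rw [𝒢.r_unit]
      push_cast
      ring
    · change F t * ((χ t / d (𝒢.r t) : ℝ) : ℂ) = 0
      simp [h0' t ht]

/-- If `G⁰` is open, every `f ∈ C_c(G)`, in particular every element of `A_c(G)`, is a single coefficient of sections from `C_c(G)`. -/
theorem exists_coeff_ofCc_eq (h𝒢 : 𝒢.IsRDiscrete) (f : C_c(G, ℂ)) :
    ∃ g a : C_c(G, ℂ), ∀ x, f x = Λ.coeff (Λ.ofCc g) (Λ.ofCc a) x := by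
  obtain ⟨a, w, hw, ha⟩ := Λ.exists_unit_evaluation h𝒢
    (f.hasCompactSupport.isCompact.image 𝒢.continuous_r)
  -- Evaluating at `t = r(x)` turns `conj f*(x⁻¹t)` into `f(x)`.
  refine ⟨𝒢.starCc f, a, fun x => ?_⟩
  rw [coeff_ofCc, ha, starCc_apply, 𝒢.inv_mul_rev (𝒢.r_unit _).symm, 𝒢.inv_unit, 𝒢.unit_mul,
    Complex.conj_conj]
  by_cases hx : f x = 0
  · rw [hx, zero_mul]
  · rw [hw _ ⟨x, subset_tsupport _ hx, rfl⟩, Complex.ofReal_one, mul_one]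

theorem exists_coeff_self_eq_of_mem_PosDef (h𝒢 : 𝒢.IsRDiscrete) {φ : G →ᵇ ℂ}
    (hφ : φ ∈ Λ.PosDef) (hc : HasCompactSupport φ) :
    ∃ ξ ∈ Λ.E2, ∀ x, φ x = Λ.coeff ξ ξ x := by
  let f : C_c(G, ℂ) := ⟨φ.toContinuousMap, hc⟩
  -- Sources are included as well as ranges: `a` enters on both sides of the inner product, and the
  -- final formula carries the factor `w (s x) * w (r x)`.
  obtain ⟨a, w, hw, ha⟩ := Λ.exists_unit_evaluation h𝒢
    (((hc.isCompact.image 𝒢.continuous_r)).union (hc.isCompact.image 𝒢.continuous_s))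
  choose S hsym hsq happ using fun u => (Λ.isPositive_convOp hφ (f := f)
    (fun _ => rfl) u).exists_sqrt
  obtain ⟨M, hM⟩ := Λ.exists_norm_convOp_le f
  obtain ⟨B, hB0, hB⟩ := Λ.exists_norm_ofCc_le a
  have happ' : ∀ ε : ℝ, 0 < ε → ∃ p : Polynomial ℝ,
      ∀ u, ‖S u - Polynomial.aeval (Λ.convOp f u) p‖ ≤ ε := fun ε hε => by
    obtain ⟨p, hp⟩ := exists_polynomial_near_sqrt M hε
    exact ⟨p, fun u => happ u M ε p hε.le (hM u) hp⟩
  have hSL : ∀ (x : G) (g : Λ.L2Fibre (𝒢.s x)),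
      Λ.leftReg x (S (𝒢.s x) g) = S (𝒢.r x) (Λ.leftReg x g) := fun x g =>
    ContinuousLinearMap.map_eq_of_polynomial_approx (V := Λ.leftRegL x)
      (fun g => Λ.leftReg_convOp f x g) (fun ε hε => (happ' ε hε).imp fun p hp => ⟨hp _, hp _⟩) g
  refine ⟨fun u => S u (Λ.ofCc a u), Λ.mem_E2_of_uniform_approx fun ε hε => ?_, fun x => ?_⟩
  · obtain ⟨p, hp⟩ := happ' (ε / (B + 1)) (by positivity)
    obtain ⟨g, hg⟩ := Λ.exists_aeval_convOp_ofCc f p a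
    refine ⟨g, fun u => ?_⟩
    rw [← hg, ← sub_apply]
    refine (ContinuousLinearMap.le_of_opNorm_le _ (hp u) _).trans ?_
    rw [div_mul_eq_mul_div, div_le_iff₀ (by positivity)]
    gcongr
    linarith [hB u]
  · have hconv : ∀ y, Λ.coeffCc f a y = starRingEnd ℂ (f (𝒢.inv y)) * w (𝒢.r y) := fun y => by
      rw [coeffCc_apply, ha]
      congr 3
      have := 𝒢.mul_unit (𝒢.inv y)
      rwa [𝒢.s_inv] at this
    have e : Λ.coeff (fun u => S u (Λ.ofCc a u)) (fun u => S u (Λ.ofCc a u)) x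
        = Λ.coeff (Λ.ofCc (Λ.coeffCc f a)) (Λ.ofCc a) x := by
      -- `⟨L_x S a, S a⟩ = ⟨S L_x a, S a⟩ = ⟨S² L_x a, a⟩ = ⟨L_x T a, a⟩`, with `S² = T`.
      rw [coeff, coeff, hSL, ← hsym, hsq, ← leftReg_convOp, convOp_ofCc]
    rw [e, coeff_ofCc, ha, hconv, 𝒢.inv_mul_rev (𝒢.r_unit _).symm, 𝒢.inv_unit, 𝒢.unit_mul,
      𝒢.r_inv_mul (𝒢.r_unit _).symm, map_mul, Complex.conj_conj, Complex.conj_ofReal]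
    change φ x = φ x * _ * _
    by_cases hx : φ x = 0
    · rw [hx, zero_mul, zero_mul]
    · have hxs := subset_tsupport _ hx
      rw [hw _ (Or.inl ⟨x, hxs, rfl⟩), hw _ (Or.inr ⟨x, hxs, rfl⟩), Complex.ofReal_one, mul_one, mul_one]

theorem coeff_zero_left (η : ∀ u, Λ.L2Fibre u) (x : G) : Λ.coeff 0 η x = 0 := by
  change inner ℂ (Λ.leftRegL x 0) _ = 0
  rw [map_zero, inner_zero_left]

end HaarSystem

end TopGroupoid

theorem proposition12 {G : Type*} [TopologicalSpace G] [LocallyCompactSpace G] [T2Space G]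
    [SecondCountableTopology G] [MeasurableSpace G] [BorelSpace G]
    (𝒢 : TopGroupoid G) (Λ : 𝒢.HaarSystem) (h𝒢 : 𝒢.IsRDiscrete) :
    (∀ φ ∈ Λ.PosDef, HasCompactSupport φ → ∃ ξ ∈ Λ.E2, ∀ x, φ x = Λ.coeff ξ ξ x) ∧
    (∀ φ ∈ Λ.Ac, ∃ ξ₁ ∈ Λ.E2, ∃ η₁ ∈ Λ.E2, ∃ ξ₂ ∈ Λ.E2, ∃ η₂ ∈ Λ.E2,
      ∀ x, φ x = Λ.coeff ξ₁ η₁ x + Λ.coeff ξ₂ η₂ x) := by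
  refine ⟨fun φ hφ hc => Λ.exists_coeff_self_eq_of_mem_PosDef h𝒢 hφ hc, fun φ hφ => ?_⟩
  obtain ⟨hcont, hsupp⟩ := Λ.continuous_and_hasCompactSupport_of_mem_Ac hφ
  obtain ⟨g, a, h⟩ := Λ.exists_coeff_ofCc_eq h𝒢 ⟨⟨φ, hcont⟩, hsupp⟩
  refine ⟨_, Λ.ofCc_mem_E2 g, _, Λ.ofCc_mem_E2 a, 0, Λ.zero_mem_E2, 0, Λ.zero_mem_E2, fun x => ?_⟩
  rw [Λ.coeff_zero_left, add_zero]
  exact h x
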